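/- For $d\ge 1$ let $\mathbb{Q}^d$ be the graph with vertex set $\{1,2\}^d$ in which two vertices are adjacent if and only if they differ in exactly one coordinate. A dimer configuration on a graph $G$ is a perfect matching of $G$, and its edges are called dimers. Given a dimer configuration, an alternating cycle is a cycle of even length in $G$ in which every second edge is a dimer; switching it means exchanging the dimer and the non-dimer edges along the cycle, which gives another dimer configuration. For an integer $\ell\ge 2$, let $\mathcal{D}_\ell(G)$ be the graph whose vertices are the dimer configurations on $G$, two of them being adjacent if and only if one is transformed into the other by switching a single alternating cycle of length at most $2\ell$. Theorem (Ergodicity on $\mathbb{Q}^d$). For every integer $d\ge 2$, the graph $\mathcal{D}_{2d-2}(\mathbb{Q}^d)$ (in which alternating cycles of length at most $4d-4$ are switched) is connected and has diameter at most $(d-1)2^{d-1}$. -/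

import Mathlib

/-- The box of side lengths `n 0, …, n (d-1)`: the vertices are the integer points of the box
(coordinates `0, …, n i - 1`), two vertices being adjacent if they differ in exactly one coordinate,
and by exactly `1` there. -/
def boxGraph (d : ℕ) (n : Fin d → ℕ) : SimpleGraph ((i : Fin d) → Fin (n i)) where
  Adj u v := ∃ i : Fin d, (∀ j, j ≠ i → u j = v j) ∧ |((u i : ℕ) : ℤ) - ((v i : ℕ) : ℤ)| = 1
  symm := ⟨by
    rintro u v ⟨i, h, h1⟩
    exact ⟨i, fun j hj => (h j hj).symm, by rw [abs_sub_comm]; exact h1⟩⟩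
  loopless := ⟨by
    rintro u ⟨i, -, h1⟩
    simp at h1⟩

/-- The unit hypercube of dimension `d`: the box with all side lengths equal to `2`. -/
abbrev unitHypercube (d : ℕ) : SimpleGraph (Fin d → Fin 2) :=
  boxGraph d (fun _ => 2)

/-- A dimer configuration on `G` is a perfect matching of `G`. -/
abbrev DimerConfig {V : Type*} (G : SimpleGraph V) : Type _ :=
  {M : G.Subgraph // M.IsPerfectMatching}

/-- A closed walk `c` is an alternating cycle for `D` if it is a cycle of even length
in which every second edge is a dimer (of two consecutive edges, exactly one is a dimer). -/
def IsAlternatingCycle {V : Type*} {G : SimpleGraph V} (D : DimerConfig G) {v : V}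
    (c : G.Walk v v) : Prop :=
  c.IsCycle ∧ Even c.length ∧
    ∀ i, i + 2 ≤ c.length →
      (D.1.Adj (c.getVert i) (c.getVert (i + 1)) ↔
        ¬ D.1.Adj (c.getVert (i + 1)) (c.getVert (i + 2)))

/-- `D'` is obtained from `D` by switching along `c`: dimers and non-dimers of `c` are exchanged,
and nothing changes off `c`. -/
def IsSwitching {V : Type*} {G : SimpleGraph V} (D D' : DimerConfig G) {v : V}
    (c : G.Walk v v) : Prop :=
  D'.1.edgeSet = symmDiff D.1.edgeSet {e | e ∈ c.edges}

theorem IsSwitching.symm {V : Type*} {G : SimpleGraph V} {D D' : DimerConfig G} {v : V}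
    {c : G.Walk v v} (h : IsSwitching D D' c) : IsSwitching D' D c := by
  unfold IsSwitching at *
  rw [h, symmDiff_symmDiff_cancel_right]

theorem IsSwitching.adj_iff {V : Type*} {G : SimpleGraph V} {D D' : DimerConfig G} {v : V}
    {c : G.Walk v v} (h : IsSwitching D D' c) {i : ℕ} (hi : i < c.length) :
    D'.1.Adj (c.getVert i) (c.getVert (i + 1)) ↔
      ¬ D.1.Adj (c.getVert i) (c.getVert (i + 1)) := by
  have hc : s(c.getVert i, c.getVert (i + 1)) ∈ c.edges := by
    rw [SimpleGraph.Walk.mk_mem_edges_iff_exists]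
    exact ⟨i, hi, rfl⟩
  rw [← SimpleGraph.Subgraph.mem_edgeSet, ← SimpleGraph.Subgraph.mem_edgeSet, h,
    Set.mem_symmDiff]
  simp only [Set.mem_ofPred_eq, hc, not_true_eq_false, and_false, true_and, false_or]

theorem IsAlternatingCycle.switch {V : Type*} {G : SimpleGraph V} {D D' : DimerConfig G} {v : V}
    {c : G.Walk v v} (hc : IsAlternatingCycle D c) (h : IsSwitching D D' c) :
    IsAlternatingCycle D' c := by
  refine ⟨hc.1, hc.2.1, fun i hi => ?_⟩
  rw [h.adj_iff (i := i) (by omega), h.adj_iff (i := i + 1) (by omega), hc.2.2 i hi]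

/-- The graph of dimer configurations on `G`, two of them being adjacent if one is
obtained from the other by switching one alternating cycle of length at most `2 * l`. -/
def dimerGraph {V : Type*} (G : SimpleGraph V) (l : ℕ) : SimpleGraph (DimerConfig G) where
  Adj D D' := ∃ (v : V) (c : G.Walk v v),
    IsAlternatingCycle D c ∧ c.length ≤ 2 * l ∧ IsSwitching D D' c
  symm := ⟨by
    rintro D D' ⟨v, c, hc, hl, h⟩
    exact ⟨v, c, hc.switch h, hl, h.symm⟩⟩
  loopless := ⟨by
    rintro D ⟨v, c, hc, -, h⟩
    have h3 := hc.1.three_le_length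
    have := h.adj_iff (i := 0) (by omega)
    tauto⟩

/-! The directions occurring among the dimers are eliminated one at a time. Suppose all dimers have
directions in `I`, where `|I| = m + 2 ≤ d`, and `x` lies on a dimer of direction `i ∈ I`. Switch an
alternating cycle through `x` whose non-dimer edges have directions in `I \ {i}`: no dimer of
direction `i` and no direction outside `I` is created. Coordinate `i` flips an even number of times
along the cycle, and only at dimers, so at least two dimers of direction `i` disappear
(`exists_adj_card_verticesInDirection_lt`). Hence `2^(d-2)` switches suffice for one direction.
After `d - 1` directions all dimers are parallel, and any two configurations meet there.

A short cycle exists by expansion (`exists_closed_reachIn`). A step is an edge with direction in `I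
\ {i}` followed by a dimer. Each parity class of an `(m+1)`-cube projects bijectively onto an
`m`-cube, where neighbours become closed neighbourhoods, so a Harper inequality is available
(`harperBound_cubeNeighbors`): `m` steps from `x` reach at least `2^m` vertices, forward as well as
backward. All of them lie in a set of at most `2^(m+1)` vertices. Enlarging the backward set
slightly forces an overlap, hence a closed walk of at most `2m + 2` steps, that is, `4m + 4 ≤ 4d -
4` edges. A shortest closed walk through `x` then gives the cycle (`exists_switching`). -/

open SimpleGraph

/-! ### Ball sizes and the numerical form of Harper's inequality. -/

/-- The size of the Hamming ball of radius `k - 1` in the hypercube of dimension `m`. -/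
def ballCard (m k : ℕ) : ℝ := ∑ i ∈ Finset.range k, (m.choose i : ℝ)

theorem ballCard_succ (m k : ℕ) : ballCard m (k + 1) = ballCard m k + m.choose k := by
  simp [ballCard, Finset.sum_range_succ]

theorem ballCard_nonneg (m k : ℕ) : 0 ≤ ballCard m k :=
  Finset.sum_nonneg fun _ _ => Nat.cast_nonneg _

theorem ballCard_succ_succ (m k : ℕ) :
    ballCard (m + 1) (k + 1) = ballCard m (k + 1) + ballCard m k := by
  induction k with
  | zero => simp [ballCard]
  | succ k ih =>
    rw [ballCard_succ (m + 1) (k + 1), ih, ballCard_succ m (k + 1), ballCard_succ m k,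
      Nat.choose_succ_succ]
    push_cast
    ring

theorem ballCard_self (m : ℕ) : ballCard m (m + 1) = 2 ^ m := by
  have := Nat.sum_range_choose m
  unfold ballCard
  exact_mod_cast this

/-- Log-concavity of the binomials makes the slopes `C(m,k+1)/C(m,k)` of the interpolated Harper
function decrease in `k`, which is its concavity. -/
theorem choose_mul_choose_le_sq (m k : ℕ) :
    m.choose k * m.choose (k + 2) ≤ m.choose (k + 1) ^ 2 := by
  have h1 := Nat.choose_succ_right_eq m k
  have h2 := Nat.choose_succ_right_eq m (k + 1)
  have h3 : m - (k + 1) ≤ m - k := by omega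
  refine Nat.le_of_mul_le_mul_right (c := k + 2) ?_ (by omega)
  calc m.choose k * m.choose (k + 2) * (k + 2)
      = m.choose k * (m.choose (k + 1 + 1) * (k + 1 + 1)) := by ring
    _ = m.choose k * (m.choose (k + 1) * (m - (k + 1))) := by rw [h2]
    _ ≤ m.choose k * (m.choose (k + 1) * (m - k)) := by gcongr
    _ = m.choose (k + 1) * (m.choose k * (m - k)) := by ring
    _ = m.choose (k + 1) * (m.choose (k + 1) * (k + 1)) := by rw [h1]
    _ ≤ m.choose (k + 1) * (m.choose (k + 1) * (k + 2)) := by gcongr; omega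
    _ = _ := by ring

/-- The lower bound of Harper's vertex-isoperimetric inequality, interpolated linearly between the
sizes of Hamming balls: sets of size `x` in the hypercube of dimension `m` have a closed
neighbourhood of size at least `y`. -/
def HarperBound (m : ℕ) (x y : ℝ) : Prop :=
  ∀ k : ℕ, ∀ t : ℝ, 0 ≤ t → t ≤ 1 → ballCard m k + t * m.choose k ≤ x →
    ballCard m (k + 1) + t * m.choose (k + 1) ≤ y

/-- Concavity of the bound, as an inequality with a chord. -/
theorem HarperBound.chord {m k : ℕ} {x y t : ℝ} (h : HarperBound m x y) (ht0 : 0 ≤ t) (ht1 : t ≤ 1)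
    (hx : ballCard m k + t * m.choose k ≤ x)
    (hx' : x ≤ ballCard m (k + 1) + t * m.choose (k + 1)) :
    (x - (ballCard m k + t * m.choose k)) *
        ((ballCard m (k + 2) + t * m.choose (k + 2)) -
          (ballCard m (k + 1) + t * m.choose (k + 1))) ≤
      (y - (ballCard m (k + 1) + t * m.choose (k + 1))) *
        ((ballCard m (k + 1) + t * m.choose (k + 1)) - (ballCard m k + t * m.choose k)) := by
  have hlc : (m.choose k : ℝ) * m.choose (k + 2) ≤ (m.choose (k + 1) : ℝ) ^ 2 := by
    exact_mod_cast choose_mul_choose_le_sq m k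
  have e1 := ballCard_succ m k
  have e2 := ballCard_succ m (k + 1)
  have h0 : (0 : ℝ) ≤ m.choose k := Nat.cast_nonneg _
  have h1 : (0 : ℝ) ≤ m.choose (k + 1) := Nat.cast_nonneg _
  have h2 : (0 : ℝ) ≤ m.choose (k + 2) := Nat.cast_nonneg _
  have H := h k
  have H' := h (k + 1)
  rw [show k + 1 + 1 = k + 2 from rfl] at e2 H'
  generalize (m.choose k : ℝ) = c0 at *
  generalize (m.choose (k + 1) : ℝ) = c1 at *
  generalize (m.choose (k + 2) : ℝ) = c2 at *
  rw [e2, e1] at *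
  generalize ballCard m k = b at *
  have hlen : 0 ≤ (1 - t) * c0 + t * c1 := by
    have : 0 ≤ 1 - t := by linarith
    positivity
  rcases le_or_gt (b + c0) x with hp | hp
  · obtain ⟨s, hs0, hst, hs⟩ : ∃ s, 0 ≤ s ∧ s ≤ t ∧ x = b + c0 + s * c1 := by
      rcases h1.eq_or_lt with hc | hc
      · exact ⟨0, le_rfl, ht0, by rw [← hc] at hx' ⊢; linarith⟩
      · refine ⟨(x - (b + c0)) / c1, div_nonneg (by linarith) h1, ?_, ?_⟩
        · rw [div_le_iff₀ hc]; linarith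
        · field_simp; ring
    have hy := H' s hs0 (by linarith) hs.ge
    -- With `y` replaced by its lower bound, this product is exactly the difference of the two sides
    -- of the claim.
    have key : 0 ≤ (1 - t) * (t - s) * (c1 ^ 2 - c0 * c2) :=
      mul_nonneg (mul_nonneg (by linarith) (by linarith)) (by linarith)
    have := mul_le_mul_of_nonneg_right (sub_le_sub_right hy (b + c0 + t * c1)) hlen
    subst hs
    nlinarith
  · have hc : 0 < c0 := by
      rcases h0.eq_or_lt with hc | hc
      · rw [← hc] at hp hx; linarith
      · exact hc
    obtain ⟨s, hst, hs1, hs⟩ : ∃ s, t ≤ s ∧ s ≤ 1 ∧ x = b + s * c0 := by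
      refine ⟨(x - b) / c0, ?_, ?_, ?_⟩
      · rw [le_div_iff₀ hc]; linarith
      · rw [div_le_iff₀ hc]; linarith
      · field_simp; ring
    have hy := H s (by linarith) hs1 hs.ge
    have key : 0 ≤ t * (s - t) * (c1 ^ 2 - c0 * c2) :=
      mul_nonneg (mul_nonneg (by linarith) (by linarith)) (by linarith)
    have := mul_le_mul_of_nonneg_right (sub_le_sub_right hy (b + c0 + t * c1)) hlen
    subst hs
    nlinarith

theorem HarperBound.zero {x y : ℝ} (hy : 1 ≤ y) : HarperBound 0 x y := by
  intro k t _ _ _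
  have : ballCard 0 (k + 1) = 1 := by
    simp [ballCard, Finset.sum_range_succ']
  simpa [this] using hy

/-- Two halves of a hypercube: `x₀`, `x₁` are the sizes of the two parts of a set and `y₀`, `y₁`
those of the two parts of its neighbourhood. -/
theorem HarperBound.add {m : ℕ} {x₀ x₁ y₀ y₁ : ℕ} (h₀ : 0 < x₀ → HarperBound m x₀ y₀)
    (h₁ : 0 < x₁ → HarperBound m x₁ y₁) (h01 : x₀ ≤ y₁) (hle : x₁ ≤ x₀)
    (hpos : 0 < x₀) : HarperBound (m + 1) ((x₀ + x₁ : ℕ) : ℝ) ((y₀ + y₁ : ℕ) : ℝ) := by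
  have hx0 : (1 : ℝ) ≤ x₀ := by exact_mod_cast hpos
  have h01' : (x₀ : ℝ) ≤ y₁ := by exact_mod_cast h01
  have hle' : (x₁ : ℝ) ≤ x₀ := by exact_mod_cast hle
  replace h₀ := h₀ hpos
  intro k t ht0 ht1 hx
  push_cast at hx ⊢
  rcases k with _ | k
  -- The radius-one ball gives `y₀ ≥ m + 1`; together with `y₁ ≥ x₀ ≥ 1` this covers every `t ≤ 1`.
  · have := h₀ 1 0 le_rfl zero_le_one (by simpa [ballCard] using hx0)
    simp only [ballCard, Finset.sum_range_succ, Finset.range_zero, Finset.sum_empty,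
      Nat.choose_zero_right, Nat.choose_one_right, zero_add] at this ⊢
    push_cast at this ⊢
    have hm : (0 : ℝ) ≤ m := Nat.cast_nonneg _
    nlinarith
  · have hA : ballCard (m + 1) (k + 1) + t * (m + 1).choose (k + 1) =
        (ballCard m (k + 1) + t * m.choose (k + 1)) + (ballCard m k + t * m.choose k) := by
      rw [ballCard_succ_succ, Nat.choose_succ_succ]; push_cast; ring
    have hB : ballCard (m + 1) (k + 1 + 1) + t * (m + 1).choose (k + 1 + 1) =
        (ballCard m (k + 2) + t * m.choose (k + 2)) +
          (ballCard m (k + 1) + t * m.choose (k + 1)) := by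
      rw [ballCard_succ_succ, Nat.choose_succ_succ]; push_cast; ring
    rw [hA] at hx
    rw [hB]
    have hβ : 0 ≤ ballCard m k + t * m.choose k :=
      add_nonneg (ballCard_nonneg m k) (by positivity)
    -- A large `x₀` suffices alone, through `y₀` and `y₁ ≥ x₀`. Otherwise both `x₀` and `x₁` lie in
    -- the interval covered by one chord, and the two chord bounds add up.
    rcases le_or_gt (ballCard m (k + 1) + t * m.choose (k + 1)) x₀ with ha | ha
    · have := h₀ (k + 1) t ht0 ht1 ha
      simp only [add_assoc, Nat.reduceAdd] at this ⊢
      linarith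
    · have hb : ballCard m k + t * m.choose k < x₁ := by linarith
      have hx1 : 0 < x₁ := by
        have : (0 : ℝ) < x₁ := by linarith
        exact_mod_cast this
      have c0 := h₀.chord ht0 ht1 (by linarith) ha.le
      have c1 := (h₁ hx1).chord ht0 ht1 hb.le (by linarith)
      have hmono : ballCard m (k + 1) + t * m.choose (k + 1) ≤
          ballCard m (k + 2) + t * m.choose (k + 2) := by
        rw [ballCard_succ m (k + 1)]
        have h1 : (0 : ℝ) ≤ m.choose (k + 1) := Nat.cast_nonneg _
        have h2 : (0 : ℝ) ≤ m.choose (k + 2) := Nat.cast_nonneg _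
        nlinarith
      generalize ballCard m k + t * m.choose k = β at *
      generalize ballCard m (k + 1) + t * m.choose (k + 1) = α at *
      generalize ballCard m (k + 2) + t * m.choose (k + 2) = γ at *
      have hαβ : 0 < α - β := by linarith
      have h1 : (α - β) * (γ - α) ≤ (α - β) * (y₀ + y₁ - 2 * α) := by
        have : (α - β) * (γ - α) ≤ (x₀ + x₁ - 2 * β) * (γ - α) :=
          mul_le_mul_of_nonneg_right (by linarith) (by linarith)
        linarith
      have := le_of_mul_le_mul_left h1 hαβ
      linarith

/-! ### Vertex isoperimetry in the hypercube. -/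

/-- The vertices reached from `A` by one step in a direction of `J`. -/
def cubeNeighbors {d : ℕ} (J : Finset (Fin d)) (A : Finset (Fin d → Fin 2)) :
    Finset (Fin d → Fin 2) :=
  J.biUnion fun j => A.image fun x => x + Pi.single j 1

theorem mem_cubeNeighbors {d : ℕ} {J : Finset (Fin d)} {A : Finset (Fin d → Fin 2)}
    {y : Fin d → Fin 2} :
    y ∈ cubeNeighbors J A ↔ ∃ j ∈ J, ∃ x ∈ A, x + Pi.single j 1 = y := by
  simp only [cubeNeighbors, Finset.mem_biUnion, Finset.mem_image]

theorem card_image_add_single {d : ℕ} (A : Finset (Fin d → Fin 2)) (j : Fin d) :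
    (A.image fun x => x + Pi.single j 1).card = A.card :=
  Finset.card_image_of_injective _ (add_left_injective _)

theorem card_le_card_cubeNeighbors {d : ℕ} {J : Finset (Fin d)} (hJ : J.Nonempty)
    (A : Finset (Fin d → Fin 2)) : A.card ≤ (cubeNeighbors J A).card := by
  obtain ⟨j, hj⟩ := hJ
  rw [← card_image_add_single A j]
  exact Finset.card_le_card fun y hy =>
    Finset.mem_biUnion.2 ⟨j, hj, hy⟩

/-- Harper's inequality, for steps in the directions of `J`. -/
theorem harperBound_cubeNeighbors {d : ℕ} (m : ℕ) : ∀ (J : Finset (Fin d)), J.card = m + 1 →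
    ∀ A : Finset (Fin d → Fin 2), A.Nonempty →
      HarperBound m A.card (cubeNeighbors J A).card := by
  induction m with
  | zero =>
    intro J hJ A hA
    apply HarperBound.zero
    have := card_le_card_cubeNeighbors (Finset.card_pos.1 (by omega)) A (J := J)
    have h2 := hA.card_pos
    exact_mod_cast h2.trans_le this
  | succ m ih =>
    intro J hJ A hA
    obtain ⟨i, J', hi, rfl, hJ'⟩ := Finset.card_eq_succ.1 hJ
    have hsplit : ∀ S : Finset (Fin d → Fin 2), ∀ a : Fin 2,
        S.card = (S.filter fun x => x i = a).card + (S.filter fun x => x i = a + 1).card := by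
      intro S a
      rw [← Finset.card_filter_add_card_filter_not (s := S) (fun x => x i = a)]
      congr 2
      ext x
      simp only [Finset.mem_filter, and_congr_right_iff]
      intro _
      generalize x i = b
      revert a b
      decide
    have hin : ∀ a : Fin 2, cubeNeighbors J' (A.filter fun x => x i = a) ⊆
        (cubeNeighbors (insert i J') A).filter fun x => x i = a := by
      intro a y hy
      obtain ⟨j, hj, x, hx, rfl⟩ := mem_cubeNeighbors.1 hy
      rw [Finset.mem_filter] at hx ⊢
      have hij : i ≠ j := by rintro rfl; exact hi hj
      exact ⟨mem_cubeNeighbors.2 ⟨j, Finset.mem_insert_of_mem hj, x, hx.1, rfl⟩,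
        by simp [hij, hx.2]⟩
    have hacross : ∀ a : Fin 2, (A.filter fun x => x i = a).card ≤
        ((cubeNeighbors (insert i J') A).filter fun x => x i = a + 1).card := by
      intro a
      rw [← card_image_add_single _ i]
      refine Finset.card_le_card fun y hy => ?_
      obtain ⟨x, hx, rfl⟩ := Finset.mem_image.1 hy
      rw [Finset.mem_filter] at hx ⊢
      exact ⟨mem_cubeNeighbors.2 ⟨i, Finset.mem_insert_self _ _, x, hx.1, rfl⟩, by simp [hx.2]⟩
    have hpart : ∀ a : Fin 2, 0 < (A.filter fun x => x i = a).card →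
        HarperBound m (A.filter fun x => x i = a).card
          ((cubeNeighbors (insert i J') A).filter fun x => x i = a).card := by
      intro a ha k t ht0 ht1 hx
      refine (ih J' hJ' _ (Finset.card_pos.1 ha) k t ht0 ht1 hx).trans ?_
      exact_mod_cast Finset.card_le_card (hin a)
    -- The half `a` is the larger one: its translate in direction `i` lies in the neighbourhood
    -- within the other half.
    obtain ⟨a, ha⟩ : ∃ a : Fin 2, (A.filter fun x => x i = a + 1).card ≤
        (A.filter fun x => x i = a).card := by
      rcases le_total (A.filter fun x => x i = 1).card (A.filter fun x => x i = 0).card with h | h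
      · exact ⟨0, h⟩
      · exact ⟨1, h⟩
    rw [hsplit A a, hsplit (cubeNeighbors (insert i J') A) a]
    refine HarperBound.add (hpart a) (hpart (a + 1)) (hacross a) ha ?_
    have := hA.card_pos
    have := hsplit A a
    omega

/-- Sets at least as large as a Hamming ball have neighbourhoods at least as large as the next
Hamming ball. -/
theorem ballCard_succ_le_card_cubeNeighbors {d m k : ℕ} {J : Finset (Fin d)} (hJ : J.card = m + 1)
    {A : Finset (Fin d → Fin 2)} (hA : A.Nonempty) (h : ballCard m k ≤ A.card) :
    ballCard m (k + 1) ≤ (cubeNeighbors J A).card := by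
  simpa using harperBound_cubeNeighbors m J hJ A hA k 0 le_rfl zero_le_one (by simpa using h)

/-! ### Cycles from vertex sequences, and switching along them. -/

/-- The walk along a sequence of vertices. -/
def walkOfSeq {V : Type*} {G : SimpleGraph V} (w : ℕ → V) :
    ∀ n : ℕ, (∀ i < n, G.Adj (w i) (w (i + 1))) → G.Walk (w 0) (w n)
  | 0, _ => .nil
  | n + 1, h => (walkOfSeq w n fun i hi => h i (hi.trans n.lt_succ_self)).concat (h n n.lt_succ_self)

theorem length_walkOfSeq {V : Type*} {G : SimpleGraph V} (w : ℕ → V) (n : ℕ)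
    (h : ∀ i < n, G.Adj (w i) (w (i + 1))) : (walkOfSeq w n h).length = n := by
  induction n with
  | zero => rfl
  | succ n ih => rw [walkOfSeq, Walk.length_concat, ih]

theorem getVert_walkOfSeq {V : Type*} {G : SimpleGraph V} (w : ℕ → V) (n : ℕ)
    (h : ∀ i < n, G.Adj (w i) (w (i + 1))) {i : ℕ} (hi : i ≤ n) :
    (walkOfSeq w n h).getVert i = w i := by
  induction n with
  | zero => obtain rfl : i = 0 := by omega
            rfl
  | succ n ih =>
    rcases hi.lt_or_eq with hi' | rfl
    · rw [walkOfSeq, Walk.concat_eq_append, Walk.getVert_append, length_walkOfSeq]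
      split_ifs with h1
      · exact ih _ (by omega)
      · obtain rfl : i = n := by omega
        simp
    · have := (walkOfSeq w (n + 1) h).getVert_length
      rwa [length_walkOfSeq] at this

theorem isCycle_of_getVert_injOn {V : Type*} {G : SimpleGraph V} {v : V} (c : G.Walk v v)
    (hlen : 3 ≤ c.length) (hinj : Set.InjOn c.getVert {i | i < c.length}) : c.IsCycle := by
  cases c with
  | nil => simp at hlen
  | @cons _ u _ h p =>
    rw [Walk.length_cons] at hlen
    have hlast : p.getVert p.length = v := p.getVert_length
    have hp : Set.InjOn p.getVert {i | i ≤ p.length} := by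
      intro a ha b hb hab
      rw [Set.mem_ofPred_eq] at ha hb
      have key : ∀ a, a < p.length → p.getVert a ≠ v := by
        intro a ha h0
        have := @hinj (a + 1) (by simpa using ha) 0 (by simp) (by simpa using h0)
        omega
      rcases ha.lt_or_eq with ha | rfl <;> rcases hb.lt_or_eq with hb | rfl
      · have := @hinj (a + 1) (by simpa using ha) (b + 1) (by simpa using hb) (by simpa using hab)
        omega
      · exact absurd (hab.trans hlast) (key a ha)
      · exact absurd (hab.symm.trans hlast) (key b hb)
      · rfl
    rw [Walk.cons_isCycle_iff]
    refine ⟨(Walk.IsPath.getVert_injOn_iff p).1 hp, fun hmem => ?_⟩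
    obtain ⟨i, hi, he⟩ := (Walk.mk_mem_edges_iff_exists p).1 hmem
    rw [Sym2.eq_iff] at he
    rcases he with ⟨h1, h2⟩ | ⟨h1, h2⟩
    · have := @hp i (by simp; omega) p.length (by simp) (h1.trans hlast.symm)
      omega
    · have e1 := @hp i (by simp; omega) 0 (by simp) (h1.trans p.getVert_zero.symm)
      have e2 := @hp (i + 1) (by simp; omega) p.length (by simp) (h2.trans hlast.symm)
      omega

/-- The vertex matched with `x`. -/
noncomputable def partner {V : Type*} {G : SimpleGraph V} (D : DimerConfig G) (x : V) : V :=
  ((Subgraph.isPerfectMatching_iff.1 D.2) x).choose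

theorem adj_partner {V : Type*} {G : SimpleGraph V} (D : DimerConfig G) (x : V) :
    D.1.Adj x (partner D x) :=
  ((Subgraph.isPerfectMatching_iff.1 D.2) x).choose_spec.1

theorem adj_iff_eq_partner {V : Type*} {G : SimpleGraph V} (D : DimerConfig G) {x y : V} :
    D.1.Adj x y ↔ y = partner D x :=
  ⟨fun h => ((Subgraph.isPerfectMatching_iff.1 D.2) x).choose_spec.2 y h,
    fun h => h ▸ adj_partner D x⟩

theorem partner_partner {V : Type*} {G : SimpleGraph V} (D : DimerConfig G) (x : V) :
    partner D (partner D x) = x :=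
  ((adj_iff_eq_partner D).1 (adj_partner D x).symm).symm

theorem partner_injective {V : Type*} {G : SimpleGraph V} (D : DimerConfig G) :
    Function.Injective (partner D) :=
  Function.Involutive.injective (partner_partner D)

/-- A cyclic sequence of dimers, each joined to the next one by an edge from its vertex in `p` to
the vertex outside `p` of the next, forms an alternating cycle, and the
configuration can be switched along it. -/
theorem exists_switching {V : Type*} {G : SimpleGraph V} (D : DimerConfig G) (p : V → Prop)
    (hp : ∀ x y, G.Adj x y → (p y ↔ ¬ p x)) (u : ℕ → V) (k : ℕ) (hk : 1 ≤ k)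
    (hu : ∀ l ≤ k, p (u l)) (hinj : Set.InjOn u {l | l ≤ k}) (hclose : u (k + 1) = u 0)
    (hadj : ∀ l ≤ k, G.Adj (u l) (partner D (u (l + 1)))) :
    ∃ (D' : DimerConfig G) (v : V) (c : G.Walk v v),
      IsAlternatingCycle D c ∧ c.length = 2 * (k + 1) ∧ IsSwitching D D' c ∧
      (∀ x y, D'.1.Adj x y → D.1.Adj x y ∨
        ∃ l ≤ k, s(x, y) = s(u l, partner D (u (l + 1)))) ∧
      ∀ l ≤ k, ¬ D'.1.Adj (u l) (partner D (u l)) := by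
  classical
  -- The cycle runs from `u l` by a non-dimer edge to the partner of `u (l + 1)`, then by the dimer
  -- to `u (l + 1)`.
  set w : ℕ → V := fun i => if Even i then u (i / 2) else partner D (u (i / 2 + 1)) with hw
  have w0 : ∀ l, w (2 * l) = u l := by intro l; simp [hw]
  have w1 : ∀ l, w (2 * l + 1) = partner D (u (l + 1)) := by
    intro l
    have : (2 * l + 1) / 2 = l := by omega
    simp [hw, this]
  have w2 : ∀ l, w (2 * l + 1 + 1) = u (l + 1) := fun l => w0 (l + 1)
  have hu' : ∀ l ≤ k + 1, p (u l) := by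
    intro l hl
    rcases hl.lt_or_eq with h | rfl
    · exact hu l (by omega)
    · rw [hclose]; exact hu 0 (by omega)
  have hpp : ∀ x, p (partner D x) ↔ ¬ p x := fun x => hp _ _ (adj_partner D x).adj_sub
  have hwadj : ∀ i < 2 * (k + 1), G.Adj (w i) (w (i + 1)) := by
    intro i hi
    obtain ⟨l, rfl | rfl⟩ := Nat.even_or_odd' i
    · rw [w0, w1]; exact hadj l (by omega)
    · rw [w1, w2]; exact (adj_partner D _).adj_sub.symm
  obtain ⟨c, hlen, hget⟩ : ∃ c : G.Walk (u 0) (u 0), c.length = 2 * (k + 1) ∧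
      ∀ i ≤ 2 * (k + 1), c.getVert i = w i := by
    refine ⟨(walkOfSeq w _ hwadj).copy (w0 0) ((w0 (k + 1)).trans hclose), ?_, fun i hi => ?_⟩
    · rw [Walk.length_copy, length_walkOfSeq]
    · rw [Walk.getVert_copy, getVert_walkOfSeq _ _ _ hi]
  have hedge : ∀ x y, s(x, y) ∈ c.edges ↔ ∃ l ≤ k, s(x, y) = s(u l, partner D (u (l + 1))) ∨
      s(x, y) = s(u l, partner D (u l)) := by
    intro x y
    rw [Walk.mk_mem_edges_iff_exists]
    constructor
    · rintro ⟨i, hi, he⟩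
      rw [hget i (by omega), hget (i + 1) (by omega)] at he
      obtain ⟨l, rfl | rfl⟩ := Nat.even_or_odd' i
      · rw [w0, w1] at he
        exact ⟨l, by omega, .inl he.symm⟩
      · rw [w1, w2, Sym2.eq_swap] at he
        rcases (show l + 1 ≤ k + 1 by omega).lt_or_eq with h | h
        · exact ⟨l + 1, by omega, .inr he.symm⟩
        · rw [h, hclose] at he
          exact ⟨0, by omega, .inr he.symm⟩
    · rintro ⟨l, hl, he | he⟩
      · refine ⟨2 * l, by omega, ?_⟩
        rw [hget _ (by omega), hget _ (by omega), w0, w1, he]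
      · obtain ⟨l', hl', h⟩ : ∃ l' ≤ k, u (l' + 1) = u l := by
          rcases l with _ | l
          · exact ⟨k, le_rfl, hclose⟩
          · exact ⟨l, by omega, rfl⟩
        refine ⟨2 * l' + 1, by omega, ?_⟩
        rw [hget _ (by omega), hget _ (by omega), w1, w2, he, h, Sym2.eq_swap]
  have hne : ∀ l ≤ k, u l ≠ u (l + 1) := by
    intro l hl h
    rcases hl.lt_or_eq with h' | rfl
    · have := hinj (show l ≤ k from hl) (show l + 1 ≤ k from h') h
      omega
    · rw [hclose] at h
      have := hinj (show l ≤ l from le_rfl) (show 0 ≤ l by omega) h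
      omega
  have hnon : ∀ l ≤ k, ¬ D.1.Adj (u l) (partner D (u (l + 1))) := by
    intro l hl h
    rw [adj_iff_eq_partner] at h
    exact hne l hl (partner_injective D h).symm
  have hinj' : Set.InjOn (fun l => u (l + 1)) {l | l ≤ k} := by
    intro a ha b hb hab
    rw [Set.mem_ofPred_eq] at ha hb
    dsimp only at hab
    rcases ha.lt_or_eq with ha | rfl <;> rcases hb.lt_or_eq with hb | rfl
    · have := hinj (show a + 1 ≤ k from ha) (show b + 1 ≤ k from hb) hab
      omega
    · rw [hclose] at hab
      have := hinj (show a + 1 ≤ b from ha) (show 0 ≤ b by omega) hab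
      omega
    · rw [hclose] at hab
      have := hinj (show 0 ≤ a by omega) (show b + 1 ≤ a from hb) hab
      omega
    · rfl
  have hcyc : c.IsCycle := by
    refine isCycle_of_getVert_injOn c (by omega) ?_
    intro a ha b hb hab
    rw [Set.mem_ofPred_eq, hlen] at ha hb
    rw [hget a (by omega), hget b (by omega)] at hab
    obtain ⟨l, rfl | rfl⟩ := Nat.even_or_odd' a <;> obtain ⟨l', rfl | rfl⟩ := Nat.even_or_odd' b
    · rw [w0, w0] at hab
      rw [hinj (show l ≤ k by omega) (show l' ≤ k by omega) hab]
    · rw [w0, w1] at hab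
      exact absurd (hab ▸ hu l (by omega)) (by rw [hpp]; exact not_not.2 (hu' _ (by omega)))
    · rw [w0, w1] at hab
      exact absurd (hab ▸ hu l' (by omega)) (by rw [hpp]; exact not_not.2 (hu' _ (by omega)))
    · rw [w1, w1] at hab
      rw [hinj' (show l ≤ k by omega) (show l' ≤ k by omega) (partner_injective D hab)]
  have halt : IsAlternatingCycle D c := by
    refine ⟨hcyc, by rw [hlen]; exact even_two_mul _, fun i hi => ?_⟩
    rw [hget i (by omega), hget (i + 1) (by omega), hget (i + 2) (by omega)]
    obtain ⟨l, rfl | rfl⟩ := Nat.even_or_odd' i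
    · rw [w0, w1, show 2 * l + 2 = 2 * l + 1 + 1 from rfl, w2]
      exact ⟨fun h => absurd h (hnon l (by omega)), fun h => absurd (adj_partner D _).symm h⟩
    · rw [w1, w2, show 2 * l + 1 + 2 = 2 * (l + 1) + 1 by ring, w1]
      exact ⟨fun _ => hnon _ (by omega), fun _ => (adj_partner D _).symm⟩
  have hsub : ∀ x y, c.toSubgraph.spanningCoe.Adj x y ↔ s(x, y) ∈ c.edges := by
    intro x y
    rw [Subgraph.spanningCoe_adj, Walk.adj_toSubgraph_iff_mem_edges]
  have hAlt : c.toSubgraph.spanningCoe.IsAlternating D.1.spanningCoe := by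
    intro x y z hyz hy hz
    rw [hsub] at hy hz
    rw [Subgraph.spanningCoe_adj, Subgraph.spanningCoe_adj]
    constructor
    · intro h1 h2
      rw [adj_iff_eq_partner] at h1 h2
      exact hyz (h1.trans h2.symm)
    · intro h2
      by_contra h1
      have non : ∀ y, s(x, y) ∈ c.edges → ¬ D.1.Adj x y →
          ∃ l ≤ k, s(x, y) = s(u l, partner D (u (l + 1))) := by
        intro y hy h
        obtain ⟨l, hl, he | he⟩ := (hedge x y).1 hy
        · exact ⟨l, hl, he⟩
        · rw [← Subgraph.mem_edgeSet, he, Subgraph.mem_edgeSet] at h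
          exact absurd (adj_partner D _) h
      obtain ⟨l, hl, he⟩ := non y hy h1
      obtain ⟨l', hl', he'⟩ := non z hz h2
      -- By bipartiteness `x` is the `u`-end of both non-dimer edges or the partner end of both;
      -- injectivity on each side makes the edges equal.
      have hq : ∀ l ≤ k, ¬ p (partner D (u (l + 1))) := fun l hl => by
        rw [hpp]; exact not_not.2 (hu' _ (by omega))
      rw [Sym2.eq_iff] at he he'
      rcases he with ⟨a1, a2⟩ | ⟨a1, a2⟩ <;> rcases he' with ⟨b1, b2⟩ | ⟨b1, b2⟩
      · have := hinj (show l ≤ k from hl) (show l' ≤ k from hl') (a1.symm.trans b1)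
        rw [a2, b2, this] at hyz
        exact hyz rfl
      · exact hq l' hl' (b1 ▸ a1 ▸ hu l hl)
      · exact hq l hl (a1 ▸ b1 ▸ hu l' hl')
      · have := hinj' (show l ≤ k from hl) (show l' ≤ k from hl')
          (partner_injective D (a1.symm.trans b1))
        rw [a2, b2, this] at hyz
        exact hyz rfl
  have hM := D.2.symmDiff_of_isAlternating hAlt hcyc.isCycles_spanningCoe_toSubgraph
  have hle : symmDiff D.1.spanningCoe c.toSubgraph.spanningCoe ≤ G := by
    rw [symmDiff_def]
    exact sup_le (sdiff_le.trans D.1.spanningCoe_le) (sdiff_le.trans c.toSubgraph.spanningCoe_le)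
  refine ⟨⟨SimpleGraph.toSubgraph _ hle, ?_⟩, u 0, c, halt, hlen, ?_, ?_, ?_⟩
  · rw [Subgraph.isPerfectMatching_iff] at hM ⊢
    exact hM
  · ext e
    induction e with | _ x y
    rw [Subgraph.mem_edgeSet, Set.mem_symmDiff, Subgraph.mem_edgeSet, Set.mem_ofPred_eq]
    rw [← hsub, ← Subgraph.spanningCoe_adj (G' := D.1)]
    simp only [toSubgraph_adj, symmDiff_def, sup_adj, sdiff_adj]
  · intro x y h
    simp only [toSubgraph_adj, symmDiff_def, sup_adj, sdiff_adj, hsub] at h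
    rcases h with h | h
    · exact .inl h.1
    · obtain ⟨l, hl, he | he⟩ := (hedge x y).1 h.1
      · exact .inr ⟨l, hl, he⟩
      · left
        rw [← Subgraph.mem_edgeSet, he, Subgraph.mem_edgeSet]
        exact adj_partner D _
  · intro l hl h
    simp only [toSubgraph_adj, symmDiff_def, sup_adj, sdiff_adj, hsub] at h
    rcases h with h | h
    · exact h.2 ((hedge _ _).2 ⟨l, hl, .inr rfl⟩)
    · exact h.2 (adj_partner D _)

/-! ### Directions of dimers and parity in the hypercube. -/

theorem add_single_add_single {d : ℕ} (x : Fin d → Fin 2) (i : Fin d) :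
    x + Pi.single i 1 + Pi.single i 1 = x := by
  rw [add_assoc, ← Pi.single_add]
  simp

theorem unitHypercube_adj {d : ℕ} {x y : Fin d → Fin 2} :
    (unitHypercube d).Adj x y ↔ ∃ i, y = x + Pi.single i 1 := by
  have key : ∀ a b : Fin 2, |((a : ℕ) : ℤ) - ((b : ℕ) : ℤ)| = 1 ↔ b = a + 1 := by decide
  refine exists_congr fun i => ?_
  rw [key]
  constructor
  · rintro ⟨h, h1⟩
    funext j
    by_cases hj : j = i
    · subst hj; simpa using h1
    · simp [hj, h j hj]
  · rintro rfl
    exact ⟨fun j hj => by simp [hj], by simp⟩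

theorem eq_of_add_single_eq {d : ℕ} {x : Fin d → Fin 2} {i j : Fin d}
    (h : x + Pi.single i 1 = x + Pi.single j 1) : i = j := by
  by_contra hij
  have := congrFun (add_left_cancel h) i
  simp [hij] at this

theorem eq_of_edge_eq {d : ℕ} {x y : Fin d → Fin 2} {i j : Fin d}
    (h : s(x, x + Pi.single i 1) = s(y, y + Pi.single j 1)) : i = j := by
  rcases Sym2.eq_iff.1 h with ⟨rfl, h2⟩ | ⟨h1, h2⟩
  · exact eq_of_add_single_eq h2
  · refine eq_of_add_single_eq (x := x + Pi.single i 1) ?_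
    rw [add_single_add_single, h2, ← h1]

/-- All dimers of the configuration have their direction in `I`. -/
def UsesDirections {d : ℕ} (D : DimerConfig (unitHypercube d)) (I : Finset (Fin d)) : Prop :=
  ∀ x, ∃ i ∈ I, partner D x = x + Pi.single i 1

/-- The vertices covered by dimers of direction `i`. -/
noncomputable def verticesInDirection {d : ℕ} (D : DimerConfig (unitHypercube d)) (i : Fin d) :
    Finset (Fin d → Fin 2) :=
  Finset.univ.filter fun x => partner D x = x + Pi.single i 1

theorem mem_verticesInDirection {d : ℕ} {D : DimerConfig (unitHypercube d)} {i : Fin d}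
    {x : Fin d → Fin 2} : x ∈ verticesInDirection D i ↔ partner D x = x + Pi.single i 1 := by
  simp [verticesInDirection]

theorem sum_add_single {d : ℕ} (x : Fin d → Fin 2) (i : Fin d) :
    ∑ l, (x + Pi.single i 1 : Fin d → Fin 2) l = ∑ l, x l + 1 := by
  simp only [Pi.add_apply, Finset.sum_add_distrib]
  congr 1
  simp [Pi.single_apply]

/-! ### Reachability and shortest closed walks. -/

/-- Reachability in exactly `n` steps. -/
def ReachIn {V : Type*} (R : V → V → Prop) : ℕ → V → V → Prop
  | 0, x, y => x = y
  | n + 1, x, y => ∃ z, R x z ∧ ReachIn R n z y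

theorem ReachIn.trans {V : Type*} {R : V → V → Prop} {a b : ℕ} {x y z : V}
    (h : ReachIn R a x y) (h' : ReachIn R b y z) : ReachIn R (a + b) x z := by
  induction a generalizing x with
  | zero => cases h; rwa [zero_add]
  | succ a ih =>
    obtain ⟨w, hw, h⟩ := h
    rw [Nat.succ_add]
    exact ⟨w, hw, ih h⟩

theorem ReachIn.single {V : Type*} {R : V → V → Prop} {x y : V} (h : R x y) : ReachIn R 1 x y :=
  ⟨y, h, rfl⟩

theorem ReachIn.exists_seq {V : Type*} {R : V → V → Prop} {n : ℕ} {x y : V}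
    (h : ReachIn R n x y) :
    ∃ f : ℕ → V, f 0 = x ∧ f n = y ∧ ∀ l < n, R (f l) (f (l + 1)) := by
  induction n generalizing x with
  | zero => exact ⟨fun _ => x, rfl, h, by simp⟩
  | succ n ih =>
    obtain ⟨w, hw, h⟩ := h
    obtain ⟨f, h0, hn, hf⟩ := ih h
    refine ⟨fun l => Nat.casesOn l x f, rfl, hn, fun l hl => ?_⟩
    rcases l with _ | l
    · simpa [h0] using hw
    · exact hf l (by omega)

theorem ReachIn.of_seq {V : Type*} {R : V → V → Prop} {n : ℕ} {f : ℕ → V}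
    (hf : ∀ l < n, R (f l) (f (l + 1))) {a b : ℕ} (hab : a ≤ b) (hb : b ≤ n) :
    ReachIn R (b - a) (f a) (f b) := by
  induction b, hab using Nat.le_induction with
  | base => rw [Nat.sub_self]; rfl
  | succ b hab ih =>
    rw [Nat.succ_sub hab]
    exact (ih (by omega)).trans (.single (hf b (by omega)))

/-- A shortest closed walk does not repeat a vertex. -/
theorem exists_injOn_closed_seq {V : Type*} {R : V → V → Prop} {n : ℕ} {x : V}
    (h : ReachIn R (n + 1) x x) :
    ∃ k ≤ n, ∃ f : ℕ → V, f 0 = x ∧ f (k + 1) = x ∧ (∀ l ≤ k, R (f l) (f (l + 1))) ∧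
      Set.InjOn f {l | l ≤ k} := by
  classical
  have hex : ∃ k, ReachIn R (k + 1) x x := ⟨n, h⟩
  obtain ⟨f, h0, h1, hf⟩ := (Nat.find_spec hex).exists_seq
  refine ⟨Nat.find hex, Nat.find_min' hex h, f, h0, h1, fun l hl => hf l (by omega), ?_⟩
  have key : ∀ a b, a < b → b ≤ Nat.find hex → f a ≠ f b := by
    intro a b hab hb he
    have r1 := ReachIn.of_seq hf (Nat.zero_le a) (by omega)
    have r2 := ReachIn.of_seq hf (show b ≤ Nat.find hex + 1 by omega) le_rfl
    rw [he, h0] at r1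
    rw [h1] at r2
    have r := r1.trans r2
    -- Cutting out the loop from `a` to `b` leaves a closed walk through `x`, still of positive
    -- length because `b ≤ Nat.find hex`.
    rw [show a - 0 + (Nat.find hex + 1 - b) = (a + (Nat.find hex - b)) + 1 by omega] at r
    have := Nat.find_min' hex r
    omega
  intro a ha b hb he
  rcases lt_trichotomy a b with h | h | h
  · exact absurd he (key a b h hb)
  · exact h
  · exact absurd he.symm (key b a h ha)

/-! ### Expansion of dimer steps inside a subcube. -/

/-- From the dimer at `u` one gets to the dimer at `v` by one edge in a direction of `J`. -/
def DimerStep {d : ℕ} (D : DimerConfig (unitHypercube d)) (J : Finset (Fin d))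
    (u v : Fin d → Fin 2) : Prop :=
  ∃ j ∈ J, partner D v = u + Pi.single j 1

theorem dimerStep_of_mem {d : ℕ} {D : DimerConfig (unitHypercube d)} {J : Finset (Fin d)}
    {A : Finset (Fin d → Fin 2)} {v : Fin d → Fin 2}
    (h : v ∈ (cubeNeighbors J A).image (partner D)) : ∃ u ∈ A, DimerStep D J u v := by
  obtain ⟨y, hy, rfl⟩ := Finset.mem_image.1 h
  obtain ⟨j, hj, u, hu, rfl⟩ := mem_cubeNeighbors.1 hy
  exact ⟨u, hu, j, hj, partner_partner _ _⟩

theorem dimerStep_of_mem' {d : ℕ} {D : DimerConfig (unitHypercube d)} {J : Finset (Fin d)}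
    {A : Finset (Fin d → Fin 2)} {u : Fin d → Fin 2}
    (h : u ∈ cubeNeighbors J (A.image (partner D))) : ∃ v ∈ A, DimerStep D J u v := by
  obtain ⟨j, hj, y, hy, rfl⟩ := mem_cubeNeighbors.1 h
  obtain ⟨v, hv, rfl⟩ := Finset.mem_image.1 hy
  exact ⟨v, hv, j, hj, (add_single_add_single _ _).symm⟩

/-- The vertices of the same parity as `x` in the subcube through `x` spanned by `I`. -/
def evenSubcube {d : ℕ} (I : Finset (Fin d)) (x : Fin d → Fin 2) : Finset (Fin d → Fin 2) :=
  Finset.univ.filter fun y => (∀ l ∉ I, y l = x l) ∧ ∑ l, y l = ∑ l, x l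

theorem mem_evenSubcube {d : ℕ} {I : Finset (Fin d)} {x y : Fin d → Fin 2} :
    y ∈ evenSubcube I x ↔ (∀ l ∉ I, y l = x l) ∧ ∑ l, y l = ∑ l, x l := by
  simp [evenSubcube]

/-- Parity determines coordinate `i` from the other coordinates. -/
theorem card_evenSubcube_le {d : ℕ} {I : Finset (Fin d)} {i : Fin d} (hi : i ∈ I)
    (x : Fin d → Fin 2) : (evenSubcube I x).card ≤ 2 ^ (I.erase i).card := by
  rw [← Finset.card_powerset]
  refine Finset.card_le_card_of_injOn (fun y => (I.erase i).filter fun l => y l ≠ x l)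
    (fun y _ => Finset.mem_powerset.2 (Finset.filter_subset _ _)) ?_
  intro y hy z hz hyz
  have hy := mem_evenSubcube.1 hy
  have hz := mem_evenSubcube.1 hz
  have hne : ∀ l, l ≠ i → y l = z l := by
    intro l hl
    by_cases hI : l ∈ I
    · have := Finset.ext_iff.1 hyz l
      simp only [Finset.mem_filter, Finset.mem_erase, hl, hI, ne_eq, not_false_eq_true, and_self,
        true_and] at this
      revert this
      generalize y l = a
      generalize z l = b
      generalize x l = c
      revert a b c
      decide
    · rw [hy.1 l hI, hz.1 l hI]
  have hsum := hy.2.trans hz.2.symm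
  rw [← Finset.add_sum_erase _ y (Finset.mem_univ i), ← Finset.add_sum_erase _ z
    (Finset.mem_univ i), Finset.sum_congr rfl fun l hl => hne l (Finset.ne_of_mem_erase hl)]
    at hsum
  funext l
  by_cases hl : l = i
  · subst hl; exact add_right_cancel hsum
  · exact hne l hl

/-- A step consists of two unit moves in directions of `I`, so it preserves parity and the
coordinates outside `I`. -/
theorem DimerStep.mem_evenSubcube_iff {d : ℕ} {D : DimerConfig (unitHypercube d)}
    {I J : Finset (Fin d)} (hD : UsesDirections D I) (hJ : J ⊆ I) {x u v : Fin d → Fin 2}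
    (h : DimerStep D J u v) : v ∈ evenSubcube I x ↔ u ∈ evenSubcube I x := by
  obtain ⟨j, hj, h⟩ := h
  obtain ⟨i, hi, hv⟩ := hD v
  have huv : u = v + Pi.single i 1 + Pi.single j 1 := by
    rw [← hv, h, add_single_add_single]
  rw [mem_evenSubcube, mem_evenSubcube, huv, sum_add_single, sum_add_single]
  have h2 : ∀ a : Fin 2, a + 1 + 1 = a := by decide
  rw [h2]
  refine and_congr_left fun _ => forall₂_congr fun l hl => ?_
  have h1 : l ≠ i := by rintro rfl; exact hl hi
  have h2 : l ≠ j := by rintro rfl; exact hl (hJ hj)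
  simp [h1, h2]

theorem ReachIn.mem_evenSubcube_iff {d : ℕ} {D : DimerConfig (unitHypercube d)}
    {I J : Finset (Fin d)} (hD : UsesDirections D I) (hJ : J ⊆ I) {n : ℕ}
    {x u v : Fin d → Fin 2} (h : ReachIn (DimerStep D J) n u v) :
    v ∈ evenSubcube I x ↔ u ∈ evenSubcube I x := by
  induction n generalizing u with
  | zero => cases h; rfl
  | succ n ih =>
    obtain ⟨w, hw, h⟩ := h
    rw [ih h, hw.mem_evenSubcube_iff hD hJ]

/-- Passing to partners preserves cardinality, so each step enlarges the lower bound from one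
Hamming ball to the next. -/
theorem exists_forward_set {d m : ℕ} (D : DimerConfig (unitHypercube d)) {J : Finset (Fin d)}
    (hJ : J.card = m + 1) (x : Fin d → Fin 2) (n : ℕ) :
    ∃ A : Finset (Fin d → Fin 2), A.Nonempty ∧ ballCard m (n + 1) ≤ A.card ∧
      ∀ v ∈ A, ReachIn (DimerStep D J) n x v := by
  induction n with
  | zero => exact ⟨{x}, by simp, by simp [ballCard], by simp [ReachIn]⟩
  | succ n ih =>
    obtain ⟨A, hA, hcard, hreach⟩ := ih
    refine ⟨(cubeNeighbors J A).image (partner D), ?_, ?_, fun v hv => ?_⟩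
    · have := card_le_card_cubeNeighbors (Finset.card_pos.1 (by omega)) A (J := J)
      exact (Finset.card_pos.1 (hA.card_pos.trans_le this)).image _
    · rw [Finset.card_image_of_injective _ (partner_injective D)]
      exact ballCard_succ_le_card_cubeNeighbors hJ hA hcard
    · obtain ⟨u, hu, huv⟩ := dimerStep_of_mem hv
      exact (hreach u hu).trans (.single huv)

theorem exists_backward_set {d m : ℕ} (D : DimerConfig (unitHypercube d)) {J : Finset (Fin d)}
    (hJ : J.card = m + 1) (x : Fin d → Fin 2) (n : ℕ) :
    ∃ A : Finset (Fin d → Fin 2), A.Nonempty ∧ ballCard m (n + 1) ≤ A.card ∧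
      ∀ v ∈ A, ReachIn (DimerStep D J) n v x := by
  induction n with
  | zero => exact ⟨{x}, by simp, by simp [ballCard], by simp [ReachIn]⟩
  | succ n ih =>
    obtain ⟨A, hA, hcard, hreach⟩ := ih
    have hA' : (A.image (partner D)).Nonempty := hA.image _
    have hc := Finset.card_image_of_injective A (partner_injective D)
    refine ⟨cubeNeighbors J (A.image (partner D)), ?_, ?_, fun v hv => ?_⟩
    · have := card_le_card_cubeNeighbors (J := J) (Finset.card_pos.1 (by omega))
        (A.image (partner D))
      exact Finset.card_pos.1 (hA'.card_pos.trans_le this)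
    · exact ballCard_succ_le_card_cubeNeighbors hJ hA' (by rwa [hc])
    · obtain ⟨u, hu, huv⟩ := dimerStep_of_mem' hv
      rw [add_comm]
      exact (ReachIn.single huv).trans (hreach u hu)

/-- Through every dimer there is a short closed walk whose other edges have directions in `J`. -/
theorem exists_closed_reachIn {d m : ℕ} {D : DimerConfig (unitHypercube d)} {I : Finset (Fin d)}
    (hD : UsesDirections D I) {i : Fin d} (hi : i ∈ I) (hI : I.card = m + 2)
    (x : Fin d → Fin 2) :
    ∃ n ≤ 2 * m + 1, ReachIn (DimerStep D (I.erase i)) (n + 1) x x := by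
  have hJ : (I.erase i).card = m + 1 := by rw [Finset.card_erase_of_mem hi]; omega
  have hx : x ∈ evenSubcube I x := mem_evenSubcube.2 ⟨fun _ _ => rfl, rfl⟩
  obtain ⟨A, -, hAc, hA⟩ := exists_forward_set D hJ x m
  obtain ⟨B, hBne, hBc, hB⟩ := exists_backward_set D hJ x m
  rw [ballCard_self] at hAc hBc
  replace hAc : 2 ^ m ≤ A.card := by exact_mod_cast hAc
  replace hBc : 2 ^ m ≤ B.card := by exact_mod_cast hBc
  have hJne : (I.erase i).Nonempty := Finset.card_pos.1 (by omega)
  set W := cubeNeighbors (I.erase i) (B.image (partner D)) with hW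
  have hWc : B.card ≤ W.card := by
    rw [← Finset.card_image_of_injective B (partner_injective D)]
    exact card_le_card_cubeNeighbors hJne _
  have hWr : ∀ v ∈ W, ReachIn (DimerStep D (I.erase i)) (m + 1) v x := by
    intro v hv
    obtain ⟨u, hu, huv⟩ := dimerStep_of_mem' hv
    rw [add_comm]
    exact (ReachIn.single huv).trans (hB u hu)
  by_cases hxW : x ∈ W
  · exact ⟨m, by omega, hWr x hxW⟩
  -- Two sets of size `2^m` could just fill the even subcube. Adding `x` gains the one vertex that
  -- makes `A` and `U` meet.
  set U := cubeNeighbors (I.erase i) ((insert x W).image (partner D)) with hU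
  have hUc : 2 ^ m + 1 ≤ U.card := by
    have := card_le_card_cubeNeighbors hJne ((insert x W).image (partner D))
    rw [Finset.card_image_of_injective _ (partner_injective D),
      Finset.card_insert_of_notMem hxW, ← hU] at this
    omega
  have hUr : ∀ v ∈ U, ReachIn (DimerStep D (I.erase i)) 1 v x ∨
      ReachIn (DimerStep D (I.erase i)) (m + 2) v x := by
    intro v hv
    obtain ⟨u, hu, huv⟩ := dimerStep_of_mem' hv
    rcases Finset.mem_insert.1 hu with rfl | hu
    · exact .inl (.single huv)
    · right
      rw [show m + 2 = 1 + (m + 1) by ring]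
      exact (ReachIn.single huv).trans (hWr u hu)
  have hsub := Finset.erase_subset i I
  have hAs : A ⊆ evenSubcube I x := fun v hv =>
    ((hA v hv).mem_evenSubcube_iff hD hsub).2 hx
  have hUs : U ⊆ evenSubcube I x := fun v hv =>
    (hUr v hv).elim (fun h => (h.mem_evenSubcube_iff hD hsub).1 hx)
      (fun h => (h.mem_evenSubcube_iff hD hsub).1 hx)
  have hmeet : ¬ Disjoint A U := by
    intro hdis
    have h1 := Finset.card_le_card (Finset.union_subset hAs hUs)
    rw [Finset.card_union_of_disjoint hdis] at h1
    have h2 := card_evenSubcube_le hi x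
    rw [hJ, pow_succ] at h2
    omega
  obtain ⟨v, hvA, hvU⟩ := Finset.not_disjoint_iff.1 hmeet
  rcases hUr v hvU with h | h
  · exact ⟨m, by omega, (hA v hvA).trans h⟩
  · refine ⟨2 * m + 1, le_rfl, ?_⟩
    rw [show 2 * m + 1 + 1 = m + (m + 2) by ring]
    exact (hA v hvA).trans h

/-! ### Eliminating directions and bounding the diameter. -/

/-- If there is a dimer of direction `i`, then a single switch removes at least two dimers of
direction `i` without using new directions. -/
theorem exists_adj_card_verticesInDirection_lt {d : ℕ} {D : DimerConfig (unitHypercube d)}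
    {I : Finset (Fin d)} (hD : UsesDirections D I) {i : Fin d} (hi : i ∈ I) (hI : 2 ≤ I.card)
    (hne : (verticesInDirection D i).Nonempty) :
    ∃ D', (dimerGraph (unitHypercube d) (2 * d - 2)).Adj D D' ∧ UsesDirections D' I ∧
      (verticesInDirection D' i).card + 4 ≤ (verticesInDirection D i).card := by
  obtain ⟨x, hx⟩ := hne
  obtain ⟨m, hm⟩ : ∃ m, I.card = m + 2 := ⟨I.card - 2, by omega⟩
  have hmd : m + 2 ≤ d := by
    rw [← hm]; simpa using Finset.card_le_univ I
  obtain ⟨n, hn, hclosed⟩ := exists_closed_reachIn hD hi hm x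
  obtain ⟨k, hkn, u, hu0, hu1, hstep, hinj⟩ := exists_injOn_closed_seq hclosed
  have hxi := mem_verticesInDirection.1 hx
  -- For `k = 0` the dimer at `x` would itself have a direction other than `i`.
  have hk : 1 ≤ k := by
    by_contra hk
    obtain rfl : k = 0 := by omega
    obtain ⟨j, hj, h⟩ := hstep 0 le_rfl
    rw [hu1, hu0, hxi] at h
    exact Finset.ne_of_mem_erase hj (eq_of_add_single_eq h).symm
  have hev : ∀ l ≤ k, u l ∈ evenSubcube I x := by
    intro l hl
    have r := ReachIn.of_seq (n := k + 1) (fun l hl => hstep l (by omega)) (Nat.zero_le l)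
      (by omega)
    rw [r.mem_evenSubcube_iff hD (Finset.erase_subset _ _), hu0]
    exact mem_evenSubcube.2 ⟨fun _ _ => rfl, rfl⟩
  -- The closing step enters `x` through its dimer, flipping coordinate `i`. Non-dimer edges keep
  -- this coordinate, so another dimer of direction `i` must flip it.
  have hcross : ∃ l, 1 ≤ l ∧ l ≤ k ∧ u l ∈ verticesInDirection D i := by
    by_contra! hno
    have hcoord : ∀ l ≤ k, u l i = x i := by
      intro l
      induction l with
      | zero => intro _; rw [hu0]
      | succ l ih =>
        intro hl
        obtain ⟨j, hj, h⟩ := hstep l (by omega)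
        obtain ⟨i', -, h'⟩ := hD (u (l + 1))
        have hii : i ≠ i' := by
          rintro rfl
          exact hno (l + 1) (by omega) hl (mem_verticesInDirection.2 h')
        have := congrFun (h'.symm.trans h) i
        simp [hii, (Finset.ne_of_mem_erase hj).symm] at this
        rw [this, ih (by omega)]
    obtain ⟨j, hj, h⟩ := hstep k le_rfl
    rw [hu1, hxi] at h
    have := congrFun h i
    simp [(Finset.ne_of_mem_erase hj).symm, hcoord k le_rfl] at this
  obtain ⟨l, hl1, hlk, hl⟩ := hcross
  have hpar : ∀ y z, (unitHypercube d).Adj y z →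
      (∑ l, z l = ∑ l, x l ↔ ¬ ∑ l, y l = ∑ l, x l) := by
    intro y z hyz
    obtain ⟨i, rfl⟩ := unitHypercube_adj.1 hyz
    rw [sum_add_single]
    generalize ∑ l, y l = a
    generalize ∑ l, x l = b
    revert a b
    decide
  have hueven : ∀ l ≤ k, ∑ r, u l r = ∑ r, x r := fun l hl => (mem_evenSubcube.1 (hev l hl)).2
  obtain ⟨D', v, c, halt, hlen, hsw, hold, hgone⟩ := exists_switching D
    (fun y => ∑ l, y l = ∑ l, x l) hpar u k hk hueven hinj (hu1.trans hu0.symm)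
    (fun l hl => by
      obtain ⟨j, -, h⟩ := hstep l hl
      exact unitHypercube_adj.2 ⟨j, h⟩)
  have hdir : ∀ y j, partner D' y = y + Pi.single j 1 →
      partner D y = y + Pi.single j 1 ∨ j ∈ I.erase i := by
    intro y j hy
    rcases hold y _ (adj_partner D' y) with h | ⟨l, hl, h⟩
    · left; rw [← hy]; exact ((adj_iff_eq_partner D).1 h).symm
    · obtain ⟨j', hj', h'⟩ := hstep l hl
      rw [hy, h'] at h
      exact .inr (eq_of_edge_eq h ▸ hj')
  -- The length is `2(k + 1) ≤ 2(2m + 2) ≤ 2(2d - 2)`.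
  refine ⟨D', ⟨v, c, halt, by omega, hsw⟩, fun y => ?_, ?_⟩
  · obtain ⟨j, hj⟩ := unitHypercube_adj.1 (adj_partner D' y).adj_sub
    refine ⟨j, ?_, hj⟩
    rcases hdir y j hj with h | h
    · obtain ⟨j', hj', h'⟩ := hD y
      exact eq_of_add_single_eq (h.symm.trans h') ▸ hj'
    · exact Finset.mem_of_mem_erase h
  · have hnot : ∀ l ≤ k, u l ∈ verticesInDirection D i → u l ∉ verticesInDirection D' i ∧
        partner D (u l) ∉ verticesInDirection D' i := by
      intro l hl hi
      rw [mem_verticesInDirection] at hi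
      rw [mem_verticesInDirection, mem_verticesInDirection, ← hi]
      refine ⟨fun h => hgone l hl (h ▸ adj_partner D' _), fun h => hgone l hl ?_⟩
      have h2 := (adj_partner D' (partner D (u l))).symm
      rw [h, hi, add_single_add_single] at h2
      rwa [hi]
    have hpm : ∀ y, y ∈ verticesInDirection D i → partner D y ∈ verticesInDirection D i := by
      intro y hy
      rw [mem_verticesInDirection] at hy ⊢
      rw [partner_partner, hy, add_single_add_single]
    have hodd : ∀ l ≤ k, ¬ ∑ r, partner D (u l) r = ∑ r, x r := fun l hl h =>
      (hpar _ _ (adj_partner D (u l)).adj_sub).1 h (hueven l hl)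
    have hx0 : u 0 ∈ verticesInDirection D i := by rwa [hu0]
    have h0l : u 0 ≠ u l := by
      intro h
      have := hinj (show 0 ≤ k by omega) (show l ≤ k from hlk) h
      omega
    have hmix : ∀ a ≤ k, ∀ b ≤ k, u a ≠ partner D (u b) := fun a ha b hb h =>
      hodd b hb (h ▸ hueven a ha)
    -- The four ends of two lost dimers: parity separates the `u`'s from their partners.
    have h4 : ({u 0, u l, partner D (u 0), partner D (u l)} : Finset (Fin d → Fin 2)).card = 4 := by
      rw [Finset.card_insert_of_notMem, Finset.card_insert_of_notMem,
        Finset.card_pair fun h => h0l (partner_injective D h)]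
      · simp [hmix l hlk 0 (by omega), hmix l hlk l hlk]
      · simp [hmix 0 (by omega) 0 (by omega), hmix 0 (by omega) l hlk, h0l]
    rw [← h4, ← Finset.card_union_of_disjoint]
    · refine Finset.card_le_card (Finset.union_subset (fun y hy => ?_) fun y hy => ?_)
      · rw [mem_verticesInDirection] at hy ⊢
        exact (hdir y i hy).resolve_right (Finset.notMem_erase i I)
      · simp only [Finset.mem_insert, Finset.mem_singleton] at hy
        rcases hy with rfl | rfl | rfl | rfl
        exacts [hx0, hl, hpm _ hx0, hpm _ hl]
    · rw [Finset.disjoint_right]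
      intro y hy
      simp only [Finset.mem_insert, Finset.mem_singleton] at hy
      rcases hy with rfl | rfl | rfl | rfl
      exacts [(hnot 0 (by omega) hx0).1, (hnot l hlk hl).1, (hnot 0 (by omega) hx0).2,
        (hnot l hlk hl).2]

theorem exists_walk_of_card_le {d : ℕ} {I : Finset (Fin d)} {i : Fin d} (hi : i ∈ I)
    (hI : 2 ≤ I.card) (n : ℕ) : ∀ D : DimerConfig (unitHypercube d), UsesDirections D I →
      (verticesInDirection D i).card ≤ 4 * n →
      ∃ D', UsesDirections D' (I.erase i) ∧
        ∃ w : (dimerGraph (unitHypercube d) (2 * d - 2)).Walk D D', w.length ≤ n := by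
  induction n with
  | zero =>
    intro D hD hc
    refine ⟨D, fun x => ?_, .nil, le_rfl⟩
    obtain ⟨j, hj, h⟩ := hD x
    refine ⟨j, Finset.mem_erase.2 ⟨?_, hj⟩, h⟩
    rintro rfl
    have := Finset.card_pos.2 ⟨x, mem_verticesInDirection.2 h⟩
    omega
  | succ n ih =>
    intro D hD hc
    by_cases hne : (verticesInDirection D i).Nonempty
    · obtain ⟨D₁, hadj, hD₁, hc₁⟩ := exists_adj_card_verticesInDirection_lt hD hi hI hne
      obtain ⟨D', hD', w, hw⟩ := ih D₁ hD₁ (by omega)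
      exact ⟨D', hD', .cons hadj w, by simpa using hw⟩
    · rw [Finset.not_nonempty_iff_eq_empty] at hne
      obtain ⟨D', hD', w, hw⟩ := ih D hD (by simp [hne])
      exact ⟨D', hD', w, by omega⟩

/-- Every configuration is transformed into one with dimers of direction `j` only. -/
theorem exists_walk_usesDirections_singleton {d : ℕ} (hd : 2 ≤ d) (j : Fin d) (n : ℕ) :
    ∀ I : Finset (Fin d), j ∈ I → I.card = n + 1 →
      ∀ D : DimerConfig (unitHypercube d), UsesDirections D I →
      ∃ D', UsesDirections D' {j} ∧
        ∃ w : (dimerGraph (unitHypercube d) (2 * d - 2)).Walk D D', w.length ≤ n * 2 ^ (d - 2) := by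
  induction n with
  | zero =>
    intro I hj hI D hD
    obtain ⟨a, rfl⟩ := Finset.card_eq_one.1 hI
    rw [Finset.mem_singleton] at hj
    subst hj
    exact ⟨D, hD, .nil, by simp⟩
  | succ n ih =>
    intro I hj hI D hD
    obtain ⟨i, hi, hij⟩ := Finset.exists_mem_ne (by omega) j (s := I)
    -- The trivial bound by all `2^d = 4 * 2^(d-2)` vertices; each switch uses up four of them.
    have hc : (verticesInDirection D i).card ≤ 4 * 2 ^ (d - 2) := by
      have := Finset.card_le_univ (verticesInDirection D i)
      rw [Fintype.card_fun, Fintype.card_fin, Fintype.card_fin] at this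
      obtain ⟨e, rfl⟩ := Nat.exists_eq_add_of_le' hd
      rw [pow_add] at this
      simpa [mul_comm] using this
    obtain ⟨D₁, hD₁, w₁, hw₁⟩ := exists_walk_of_card_le hi (by omega) _ D hD hc
    obtain ⟨D', hD', w, hw⟩ := ih (I.erase i) (Finset.mem_erase.2 ⟨hij.symm, hj⟩)
      (by rw [Finset.card_erase_of_mem hi]; omega) D₁ hD₁
    refine ⟨D', hD', w₁.append w, ?_⟩
    rw [Walk.length_append, add_mul, one_mul]
    omega

theorem UsesDirections.eq_of_singleton {d : ℕ} {j : Fin d} {D D' : DimerConfig (unitHypercube d)}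
    (hD : UsesDirections D {j}) (hD' : UsesDirections D' {j}) : D = D' := by
  have key : ∀ {D : DimerConfig (unitHypercube d)}, UsesDirections D {j} → ∀ x,
      partner D x = x + Pi.single j 1 := by
    intro D hD x
    obtain ⟨i, hi, h⟩ := hD x
    rwa [Finset.mem_singleton.1 hi] at h
  refine Subtype.ext (Subgraph.ext ?_ ?_)
  · rw [D.2.2.verts_eq_univ, D'.2.2.verts_eq_univ]
  · funext x y
    rw [adj_iff_eq_partner, adj_iff_eq_partner, key hD, key hD']

/-- The edges of direction `j` form a configuration. -/
theorem nonempty_dimerConfig_unitHypercube {d : ℕ} (j : Fin d) :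
    Nonempty (DimerConfig (unitHypercube d)) := by
  refine ⟨⟨{ verts := Set.univ
             Adj := fun x y => y = x + Pi.single j 1
             adj_sub := fun h => unitHypercube_adj.2 ⟨j, h⟩
             edge_vert := fun _ => Set.mem_univ _
             symm := ⟨fun x y h => by rw [h, add_single_add_single]⟩ }, ?_⟩⟩
  rw [Subgraph.isPerfectMatching_iff]
  exact fun x => ⟨_, rfl, fun _ h => h⟩

/-- Both configurations are brought to the same parallel configuration, each within `(d - 1) *
2^(d-2)` switches; switches are reversible. -/
theorem exists_walk_length_le {d : ℕ} (hd : 2 ≤ d) (D D' : DimerConfig (unitHypercube d)) :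
    ∃ w : (dimerGraph (unitHypercube d) (2 * d - 2)).Walk D D',
      w.length ≤ (d - 1) * 2 ^ (d - 1) := by
  have huniv : ∀ D : DimerConfig (unitHypercube d), UsesDirections D Finset.univ := by
    intro D x
    obtain ⟨j, hj⟩ := unitHypercube_adj.1 (adj_partner D x).adj_sub
    exact ⟨j, Finset.mem_univ _, hj⟩
  have hcard : (Finset.univ : Finset (Fin d)).card = (d - 1) + 1 := by
    rw [Finset.card_fin]; omega
  have hsingle := exists_walk_usesDirections_singleton hd ⟨0, by omega⟩ (d - 1) _
    (Finset.mem_univ _) hcard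
  obtain ⟨E, hE, w, hw⟩ := hsingle D (huniv D)
  obtain ⟨E', hE', w', hw'⟩ := hsingle D' (huniv D')
  obtain rfl := hE.eq_of_singleton hE'
  refine ⟨w.append w'.reverse, ?_⟩
  rw [Walk.length_append, Walk.length_reverse, show d - 1 = d - 2 + 1 by omega, pow_succ]
  rw [show d - 1 = d - 2 + 1 by omega] at hw hw'
  calc _ ≤ _ := add_le_add hw hw'
    _ = _ := by ring

theorem mainTheorem4 (d : ℕ) (hd : 2 ≤ d) :
    (dimerGraph (unitHypercube d) (2 * d - 2)).Connected ∧
      (dimerGraph (unitHypercube d) (2 * d - 2)).ediam ≤ (((d - 1) * 2 ^ (d - 1) : ℕ) : ℕ∞) := by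
  constructor
  · have := nonempty_dimerConfig_unitHypercube (d := d) ⟨0, by omega⟩
    exact ⟨fun D D' => (exists_walk_length_le hd D D').choose.reachable⟩
  · refine ediam_le_of_edist_le fun D D' => ?_
    obtain ⟨w, hw⟩ := exists_walk_length_le hd D D'
    exact w.edist_le.trans (by exact_mod_cast hw)
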